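/- Let $\mathrm G=(\mathrm V,\mathrm E)$, $\mathrm V=\{1,\dots,n\}$, be a strongly connected directed graph, $\mathrm N_i=\{j\ne i:(j,i)\in \mathrm E\}$, and let $W$ be a doubly stochastic $n\times n$ matrix with nonnegative entries such that, for $i\neq j$, $W_{ij}>0$ if and only if $(j,i)\in \mathrm E$, and whose second largest singular value satisfies $\sigma_2=\sigma_2(W)<1$ (with $\sigma_2=0$ if $n=1$). Let $m\ge 1$ and $T\ge 2$, and let $\mathbf h_i(t)\in\mathbb R^m$, $z_i(t)\in\mathbb R$ ($i\in \mathrm V$, $1\le t\le T$) be fixed data with losses $\theta_{i,t}(\mathbf y)=\frac12(\mathbf h_i(t)^{\mathsf T}\mathbf y-z_i(t))^2$. Let $\mathbf y^\star$ be a minimizer over $\mathbb R^m$ of $\sum_{t=1}^T\sum_{j=1}^n\theta_{j,t}$. Assume, for some constants $\alpha_{\mathbf h},\theta^\star>0$: (i) for at least one $t\in\{1,\dots,T\}$ the $n\times m$ matrix with rows $\mathbf h_1(t)^{\mathsf T},\dots,\mathbf h_n(t)^{\mathsf T}$ has rank $m$; (ii) $\|\mathbf h_i(t)\|^2\le\alpha_{\mathbf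 h}$ for all $i,t$; (iii) $|\mathbf h_i(t)^{\mathsf T}\mathbf y^\star-z_i(t)|\le\theta^\star$ for all $i,t$. Assume moreover $\alpha_{\mathbf h}<n$ and let $\beta=\frac34$, $\epsilon=T^{-1/2}$ and $\kappa>\frac{2nm^2\alpha_{\mathbf h}}{n-\alpha_{\mathbf h}}$. Consider the algorithm DOLR-BF with deterministic initial estimates $\mathbf x_1(1),\dots,\mathbf x_n(1)\in\mathbb R^m$: let $\mathbf u_i(t)$ ($i\in \mathrm V$, $1\le t\le T$) be independent and uniformly distributed on the unit sphere of $\mathbb R^m$; in round $t$ node $i$ queries its loss at two points, computes $$g_i(t)=\tfrac{m}{2\epsilon}\big(\theta_{i,t}(\mathbf x_i(t)+\epsilon \mathbf u_i(t))-\theta_{i,t}(\mathbf x_i(t)-\epsilon \mathbf u_i(t))\big)\mathbf u_i(t),\qquad l_i(t)=\mathbf x_i(t)-\tfrac{1}{\kappa T^\beta}g_i(t),$$ and sets $\mathbf x_i(t+1)=W_{ii}\,l_i(t)+\sum_{j\in \mathrm N_i}W_{ij}\,l_j(t)$. Then there is a constant $C>0$ depending only on $\alpha_{\mathbf h}$ and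 $\theta^\star$ such that, for every node $i\in \mathrm V$, the random variables $\theta_{j,t}(\mathbf x_i(t))$ are integrable and $$\sum_{t=1}^T\sum_{j=1}^n\mathbb E\big[\theta_{j,t}(\mathbf x_i(t))\big]-\sum_{t=1}^T\sum_{j=1}^n\theta_{j,t}(\mathbf y^\star)\;\le\; B_{\mathrm G}\,T^{3/4},$$ where, with $D=\sum_{i=1}^n\|\mathbf x_i(1)-\mathbf y^\star\|^2=\|\mathbf x(1)-\mathbf 1_n\otimes\mathbf y^\star\|^2$, $$B_{\mathrm G}=C\left[\Big(\frac{\sigma_2}{1-\sigma_2}\Big)^2\big(n^5m^2+n^4m^4+n^3m^2D\big)+n+(n+\kappa)D\right].$$ (For fixed $\kappa$ and $\sigma_2$ bounded away from $0$ the terms $n+(n+\kappa)D$ are absorbed, so that $B_{\mathrm G}=O\big((\tfrac{\sigma_2}{1-\sigma_2})^2(n^5m^2+n^4m^4+n^3m^2D)\big)$.) -/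

import Mathlib

open MeasureTheory ProbabilityTheory

noncomputable section

/-- The decision space `ℝ^m` with its Euclidean norm. -/
abbrev Vec (m : ℕ) : Type := EuclideanSpace ℝ (Fin m)

/-- The square loss `θ(y) = (hᵀ y - z)² / 2` of the predictor `y` on the sample `(h, z)`. -/
def sqLoss {m : ℕ} (h : Vec m) (z : ℝ) (y : Vec m) : ℝ :=
  (1 / 2) * (inner ℝ h y - z) ^ 2

/-- Network-wide cumulative loss over the rounds `0, …, T - 1` of a fixed predictor `y`. -/
def cumLoss {n m : ℕ} (h : Fin n → ℕ → Vec m) (z : Fin n → ℕ → ℝ) (T : ℕ) (y : Vec m) : ℝ :=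
  ∑ t ∈ Finset.range T, ∑ j, sqLoss (h j t) (z j t) y

/-- The `n × m` matrix `H(t)` whose `i`-th row is `h_i(t)ᵀ`. -/
def covMatrix {n m : ℕ} (h : Fin n → ℕ → Vec m) (t : ℕ) : Matrix (Fin n) (Fin m) ℝ :=
  Matrix.of fun i k => h i t k

/-- In-neighbours of `i` other than `i` itself: the nodes `j ≠ i` with an edge `(j, i)`. -/
def inNbrs {n : ℕ} (G : Digraph (Fin n)) (i : Fin n) : Finset (Fin n) :=
  open Classical in Finset.univ.filter fun j => j ≠ i ∧ G.Adj j i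

/-- Every node of the directed graph can be reached from every other one. -/
def StronglyConnected {n : ℕ} (G : Digraph (Fin n)) : Prop :=
  ∀ i j, Relation.ReflTransGen G.Adj i j

/-- The second largest singular value of a square matrix, counted with multiplicity
(singular values are indexed from `0`, in decreasing order; the value is `0` if `n = 1`). -/
def sigmaTwo {n : ℕ} (W : Matrix (Fin n) (Fin n) ℝ) : ℝ :=
  (Matrix.toEuclideanLin W).singularValues 1

/-- Standing assumptions on the network: `G` is strongly connected, and `W` is a doubly stochastic
matrix of nonnegative weights whose off-diagonal support is the edge set of `G` and whose second
largest singular value is less than `1`. -/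
structure IsNetwork {n : ℕ} (G : Digraph (Fin n)) (W : Matrix (Fin n) (Fin n) ℝ) : Prop where
  connected : StronglyConnected G
  support : ∀ i j, i ≠ j → (0 < W i j ↔ G.Adj j i)
  stochastic : W ∈ doublyStochastic ℝ (Fin n)
  sigmaTwo_lt_one : sigmaTwo W < 1

/-- The uniform probability distribution on the unit sphere, as a measure on `ℝ^m`: the normalized
surface measure. -/
def uniformSphere (m : ℕ) : Measure (Vec m) :=
  (((volume : Measure (Vec m)).toSphere Set.univ)⁻¹ •
    (volume : Measure (Vec m)).toSphere).map Subtype.val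

/-- Two-point gradient estimator at `x` along `u`, which uses the function `f` only through its
values at `x + ε u` and `x - ε u`. -/
def twoPointGrad {m : ℕ} (ε : ℝ) (f : Vec m → ℝ) (x u : Vec m) : Vec m :=
  ((m : ℝ) / (2 * ε) * (f (x + ε • u) - f (x - ε • u))) • u

/-- The local step `l_j(t) = x_j(t) - g_{j,t}(x_j(t)) / (κ T^β)` from the current estimate `x`. -/
def localStep {m : ℕ} (T : ℕ) (β ε κ : ℝ) (f : Vec m → ℝ) (x u : Vec m) : Vec m :=
  x - (1 / (κ * (T : ℝ) ^ β)) • twoPointGrad ε f x u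

/-- The iterates of the distributed algorithm with two-point bandit feedback (DOLR-BF), for given
initial estimates `x₁` and given query directions `u i t`. Rounds are numbered from `0`, so
`dolrBF … t i` is the predictor which node `i` holds in the `(t + 1)`-st round. -/
def dolrBF {n m : ℕ} (G : Digraph (Fin n)) (W : Matrix (Fin n) (Fin n) ℝ)
    (h : Fin n → ℕ → Vec m) (z : Fin n → ℕ → ℝ) (T : ℕ) (β ε κ : ℝ)
    (x₁ : Fin n → Vec m) (u : Fin n → ℕ → Vec m) : ℕ → Fin n → Vec m
  | 0 => x₁
  | t + 1 => fun i =>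
      let x := dolrBF G W h z T β ε κ x₁ u t
      let l : Fin n → Vec m := fun j =>
        localStep T β ε κ (sqLoss (h j t) (z j t)) (x j) (u j t)
      W i i • l i + ∑ j ∈ inNbrs G i, W i j • l j

/-- The random predictors of DOLR-BF, for random query directions `u i t : Ω → ℝ^m`. -/
def dolrBFProcess {n m : ℕ} {Ω : Type*} (G : Digraph (Fin n)) (W : Matrix (Fin n) (Fin n) ℝ)
    (h : Fin n → ℕ → Vec m) (z : Fin n → ℕ → ℝ) (T : ℕ) (β ε κ : ℝ)
    (x₁ : Fin n → Vec m) (u : Fin n → ℕ → Ω → Vec m) (t : ℕ) (i : Fin n) (ω : Ω) : Vec m :=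
  dolrBF G W h z T β ε κ x₁ (fun j s => u j s ω) t i

/-- The expected regret at node `i` after `T` rounds of the random predictors `x t i`, relative to
the fixed predictor `y`. -/
def expRegret {n m : ℕ} {Ω : Type*} [MeasurableSpace Ω] (P : Measure Ω)
    (h : Fin n → ℕ → Vec m) (z : Fin n → ℕ → ℝ) (T : ℕ)
    (x : ℕ → Fin n → Ω → Vec m) (y : Vec m) (i : Fin n) : ℝ :=
  (∑ t ∈ Finset.range T, ∑ j, ∫ ω, sqLoss (h j t) (z j t) (x t i ω) ∂P) - cumLoss h z T y

/-- The random query directions of the rounds `0, …, T - 1` are independent (over nodes and rounds)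
and uniformly distributed on the unit sphere. -/
structure IsUniformDirections {n m : ℕ} {Ω : Type*} [MeasurableSpace Ω] (P : Measure Ω) (T : ℕ)
    (u : Fin n → ℕ → Ω → Vec m) : Prop where
  measurable : ∀ i, ∀ t < T, Measurable (u i t)
  law : ∀ i, ∀ t < T, P.map (u i t) = uniformSphere m
  indep : iIndepFun (fun (p : Fin n × Fin T) => u p.1 p.2) P

/-- Squared distance `‖x(1) - 1 ⊗ y‖²` of the stacked initial estimates from `n` copies of `y`. -/
def initDist {n m : ℕ} (x₁ : Fin n → Vec m) (y : Vec m) : ℝ :=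
  ∑ i, ‖x₁ i - y‖ ^ 2

end

/-!
# Expected regret of distributed online regression with two-point feedback

For the square loss of a sample `(h, z)` the two-point estimator at `x` equals
`m (hᵀx - z) (hᵀu) u`, whatever the query radius (`twoPointGrad_sqLoss`). The query direction `u`
is independent of the estimate `x`, and the uniform distribution on the sphere has second moment
matrix `I / m`. The estimator is therefore unbiased, and its expected square is at most `m α` times
the expected square of the residual `hᵀx - z` (`IsRandomRound.integral_inner_twoPointGrad`,
`IsRandomRound.integral_norm_twoPointGrad_sq`). This leads to three estimates for one round with
step size `η`, in which `R` is the expected total squared residual of the estimates, `S` that of the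
fixed predictor `y`, `V` the expected total squared distance of the estimates to `y`, and `A` their
expected disagreement, that is, the total squared distance to their mean:

* `V' ≤ V - η (R - S) + η² m α R`, because mixing by a doubly stochastic matrix does not
  increase `V` (`IsRandomRound.integral_dist_nextEstimate_le`);
* `A' ≤ σ₂ A + σ₂² / (1 - σ₂) η² m α R`, because the weight matrix contracts the vectors of zero sum
  by `σ₂` (`sum_sq_mulVec_le`, `IsRandomRound.integral_disagreement_nextEstimate_le`);
* the expected losses at the estimate of one node are at most `(1 + μ) R / 2 + 4 n α A / μ`, for any
  `0 < μ ≤ 1` (`IsRandomRound.integral_sum_sqLoss_le`).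

The lower bound on `κ` gives `η m α ≤ T^{-3/4} / 2`. The first recursion, summed over the rounds,
then bounds the total of `R - S` and the total of `R`, and the second bounds the total of `A`. With
`μ = T^{-1/4}` the third estimate turns these into the regret bound (`regret_arith`).
-/

/-! ### Contraction of the disagreement by the weight matrix -/

/-- A doubly stochastic matrix with `σ₂ < 1` contracts the vectors of zero sum by the factor `σ₂`.
The all-ones vector is fixed by `WᵀW`, so it is orthogonal to the eigenvectors of `WᵀW` with
eigenvalue `σ_k² < 1`, `k ≥ 1`; it thus spans the leading eigenline, and the
orthogonal complement of that line is spanned by the other eigenvectors. -/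
lemma sum_sq_mulVec_le {n : ℕ} {W : Matrix (Fin n) (Fin n) ℝ} (hW : W ∈ doublyStochastic ℝ (Fin n))
    (hσ : sigmaTwo W < 1) (v : EuclideanSpace ℝ (Fin n)) (hv : ∑ i, v i = 0) :
    ∑ i, (∑ j, W i j * v j) ^ 2 ≤ sigmaTwo W ^ 2 * ∑ i, v i ^ 2 := by
  set A := Matrix.toEuclideanLin W with hA
  have hn : Module.finrank ℝ (EuclideanSpace ℝ (Fin n)) = n := by simp
  have hS := A.isSymmetric_adjoint_comp_self
  set b := hS.eigenvectorBasis hn with hb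
  have hA_apply : ∀ (x : EuclideanSpace ℝ (Fin n)) i, A x i = ∑ j, W i j * x j := fun x i ↦ by
    simp [hA, Matrix.toLpLin_apply, Matrix.mulVec, dotProduct]
  set e : EuclideanSpace ℝ (Fin n) := WithLp.toLp 2 fun _ ↦ 1 with he
  have hinner_e : ∀ x : EuclideanSpace ℝ (Fin n), inner ℝ e x = ∑ i, x i := fun x ↦ by
    simp [he, PiLp.inner_apply]
  have hsum_A : ∀ x, ∑ i, A x i = ∑ i, x i := fun x ↦ by
    simp_rw [hA_apply]
    rw [Finset.sum_comm]
    simp_rw [← Finset.sum_mul, sum_col_of_mem_doublyStochastic hW, one_mul]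
  have hAe : A e = e := by
    ext i
    rw [hA_apply]
    simpa [he] using sum_row_of_mem_doublyStochastic hW i
  have hfix : (A.adjoint ∘ₗ A) e = e := by
    refine ext_inner_right ℝ fun x ↦ ?_
    rw [LinearMap.comp_apply, LinearMap.adjoint_inner_left, hAe, hinner_e, hinner_e, hsum_A]
  have heig : ∀ k, hS.eigenvalues hn k = A.singularValues k ^ 2 :=
    fun k ↦ (A.sq_singularValues_fin hn k).symm
  have hle : ∀ k : Fin n, 1 ≤ (k : ℕ) → hS.eigenvalues hn k ≤ sigmaTwo W ^ 2 := fun k hk ↦ by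
    rw [heig]
    exact pow_le_pow_left₀ (A.singularValues_nonneg _) (A.singularValues_antitone hk) 2
  have hσ0 : 0 ≤ sigmaTwo W := A.singularValues_nonneg 1
  have hbe : ∀ k : Fin n, 1 ≤ (k : ℕ) → inner ℝ (b k) e = 0 := fun k hk ↦ by
    have h1 : inner ℝ ((A.adjoint ∘ₗ A) (b k)) e = inner ℝ (b k) e := by
      rw [hS (b k) e, hfix]
    rw [hb, hS.apply_eigenvectorBasis, inner_smul_left] at h1
    have h2 : hS.eigenvalues hn k < 1 := (hle k hk).trans_lt (by nlinarith)
    have h3 : (hS.eigenvalues hn k - 1) * inner ℝ (b k) e = 0 := by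
      simp only [RCLike.ofReal_real_eq_id, id_eq, conj_trivial] at h1
      rw [hb]; linarith
    exact (mul_eq_zero.1 h3).resolve_left (by linarith)
  have hbv : ∀ k : Fin n, (k : ℕ) = 0 → inner ℝ (b k) v = 0 := fun k hk ↦ by
    have h1 : inner ℝ e v = inner ℝ (b k) e * inner ℝ (b k) v := by
      rw [← b.sum_inner_mul_inner e v, Finset.sum_eq_single k]
      · rw [real_inner_comm]
      · intro l _ hl
        have : 1 ≤ (l : ℕ) := by
          rcases Nat.eq_zero_or_pos (l : ℕ) with h | h
          · exact absurd (Fin.ext (h.trans hk.symm)) hl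
          · exact h
        rw [real_inner_comm, hbe l this, zero_mul]
      · simp
    have h2 : inner ℝ e e = inner ℝ (b k) e * inner ℝ (b k) e := by
      rw [← b.sum_inner_mul_inner e e, Finset.sum_eq_single k]
      · rw [real_inner_comm]
      · intro l _ hl
        have : 1 ≤ (l : ℕ) := by
          rcases Nat.eq_zero_or_pos (l : ℕ) with h | h
          · exact absurd (Fin.ext (h.trans hk.symm)) hl
          · exact h
        rw [hbe l this, mul_zero]
      · simp
    rw [hinner_e, hv] at h1
    refine (mul_eq_zero.1 h1.symm).resolve_left fun h0 ↦ ?_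
    have hpos := k.pos
    rw [hinner_e, h0] at h2
    simp [he] at h2
    omega
  have hAv : ∑ i, (∑ j, W i j * v j) ^ 2 = inner ℝ ((A.adjoint ∘ₗ A) v) v := by
    rw [LinearMap.comp_apply, LinearMap.adjoint_inner_left, real_inner_self_eq_norm_sq,
      EuclideanSpace.norm_sq_eq]
    simp [hA_apply]
  have hvv : ∑ i, v i ^ 2 = ∑ k, inner ℝ (b k) v ^ 2 := by
    rw [b.sum_sq_inner_right v, EuclideanSpace.norm_sq_eq]
    simp
  rw [hAv, hvv, ← b.sum_inner_mul_inner, Finset.mul_sum]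
  refine Finset.sum_le_sum fun k _ ↦ ?_
  have h1 : inner ℝ ((A.adjoint ∘ₗ A) v) (b k) = hS.eigenvalues hn k * inner ℝ (b k) v := by
    rw [hS v (b k), hb, hS.apply_eigenvectorBasis, inner_smul_right, real_inner_comm]
    simp
  rw [h1, mul_assoc, ← sq]
  -- the leading term vanishes; in the others the eigenvalue is at most `σ₂²`
  rcases Nat.eq_zero_or_pos (k : ℕ) with h | h
  · simp [hbv k h]
  · exact mul_le_mul_of_nonneg_right (hle k h) (sq_nonneg _)

/-- The contraction `sum_sq_mulVec_le`, applied to every coordinate of a family of vectors. -/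
lemma sum_norm_sq_mix_le {n m : ℕ} {W : Matrix (Fin n) (Fin n) ℝ}
    (hW : W ∈ doublyStochastic ℝ (Fin n)) (hσ : sigmaTwo W < 1) (l : Fin n → Vec m)
    (hl : ∑ i, l i = 0) :
    ∑ i, ‖∑ j, W i j • l j‖ ^ 2 ≤ sigmaTwo W ^ 2 * ∑ i, ‖l i‖ ^ 2 := by
  simp_rw [EuclideanSpace.norm_sq_eq, Real.norm_eq_abs, sq_abs]
  rw [Finset.sum_comm, Finset.sum_comm (f := fun i k ↦ l i k ^ 2), Finset.mul_sum]
  refine Finset.sum_le_sum fun k _ ↦ ?_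
  have := sum_sq_mulVec_le hW hσ (WithLp.toLp 2 fun i ↦ l i k) (by
    have := congrArg (fun x : Vec m ↦ x k) hl
    simpa using this)
  simpa using this

/-- The mean of a family of vectors, one for each node. -/
noncomputable def nodeMean {n m : ℕ} (x : Fin n → Vec m) : Vec m := (n : ℝ)⁻¹ • ∑ i, x i

/-- The disagreement of a family of vectors: the sum of the squared distances to their mean. -/
noncomputable def disagreement {n m : ℕ} (x : Fin n → Vec m) : ℝ := ∑ i, ‖x i - nodeMean x‖ ^ 2

lemma disagreement_nonneg {n m : ℕ} (x : Fin n → Vec m) : 0 ≤ disagreement x :=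
  Finset.sum_nonneg fun _ _ ↦ sq_nonneg _

lemma sum_sub_nodeMean {n m : ℕ} (x : Fin n → Vec m) : ∑ i, (x i - nodeMean x) = 0 := by
  rcases Nat.eq_zero_or_pos n with rfl | hn
  · simp
  · have : (n : ℝ) ≠ 0 := by positivity
    rw [Finset.sum_sub_distrib, Finset.sum_const, Finset.card_univ, Fintype.card_fin, nodeMean,
      ← Nat.cast_smul_eq_nsmul ℝ, smul_smul, mul_inv_cancel₀ this, one_smul, sub_self]

/-- The mean minimizes the sum of the squared distances. -/
lemma disagreement_le {n m : ℕ} (x : Fin n → Vec m) (y : Vec m) :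
    disagreement x ≤ ∑ i, ‖x i - y‖ ^ 2 := by
  have h : ∀ i, ‖x i - y‖ ^ 2 = ‖x i - nodeMean x‖ ^ 2
      + 2 * inner ℝ (x i - nodeMean x) (nodeMean x - y) + ‖nodeMean x - y‖ ^ 2 := fun i ↦ by
    rw [← norm_add_sq_real, sub_add_sub_cancel]
  simp_rw [h, Finset.sum_add_distrib, ← Finset.mul_sum, ← sum_inner, sum_sub_nodeMean]
  simp only [inner_zero_left, mul_zero, add_zero]
  exact le_add_of_nonneg_right (Finset.sum_nonneg fun _ _ ↦ sq_nonneg _)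

lemma sum_norm_sub_sq_le {n m : ℕ} (x : Fin n → Vec m) (i : Fin n) :
    ∑ j, ‖x i - x j‖ ^ 2 ≤ 4 * n * disagreement x := by
  have h : ∀ j, ‖x i - x j‖ ^ 2 ≤ 2 * ‖x i - nodeMean x‖ ^ 2 + 2 * ‖x j - nodeMean x‖ ^ 2 :=
    fun j ↦ by
      have h1 := norm_sub_le (x i - nodeMean x) (x j - nodeMean x)
      rw [sub_sub_sub_cancel_right] at h1
      have h2 := pow_le_pow_left₀ (norm_nonneg _) h1 2
      nlinarith [sq_nonneg (‖x i - nodeMean x‖ - ‖x j - nodeMean x‖)]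
  have hi : ‖x i - nodeMean x‖ ^ 2 ≤ disagreement x :=
    Finset.single_le_sum (f := fun i ↦ ‖x i - nodeMean x‖ ^ 2) (fun _ _ ↦ sq_nonneg _)
      (Finset.mem_univ i)
  have hn : (1 : ℝ) ≤ n := by exact_mod_cast i.pos
  have hd := disagreement_nonneg x
  calc ∑ j, ‖x i - x j‖ ^ 2
      ≤ ∑ j, (2 * ‖x i - nodeMean x‖ ^ 2 + 2 * ‖x j - nodeMean x‖ ^ 2) :=
        Finset.sum_le_sum fun j _ ↦ h j
    _ = 2 * n * ‖x i - nodeMean x‖ ^ 2 + 2 * disagreement x := by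
        rw [Finset.sum_add_distrib, ← Finset.mul_sum, ← Finset.mul_sum, Finset.sum_const,
          Finset.card_univ, Fintype.card_fin, nsmul_eq_mul, disagreement]
        ring
    _ ≤ 4 * n * disagreement x := by nlinarith

/-- One round of mixing after a local step along `-η g` turns the disagreement `a` into at most
`σ₂² (√a + η ‖g‖)²`. Young's inequality, with weights chosen so that the bound keeps the factor
`σ₂`, makes it linear in `a` and `‖g‖²`. -/
lemma disagreement_mix_le {n m : ℕ} {W : Matrix (Fin n) (Fin n) ℝ}
    (hW : W ∈ doublyStochastic ℝ (Fin n)) (hσ : sigmaTwo W < 1) (x g : Fin n → Vec m) (η : ℝ) :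
    disagreement (fun i ↦ ∑ j, W i j • (x j - η • g j)) ≤
      sigmaTwo W * disagreement x
        + sigmaTwo W ^ 2 / (1 - sigmaTwo W) * η ^ 2 * ∑ j, ‖g j‖ ^ 2 := by
  set σ := sigmaTwo W with hσdef
  have hσ0 : 0 ≤ σ := (Matrix.toEuclideanLin W).singularValues_nonneg 1
  have hσ1 : 0 < 1 - σ := by linarith
  set l : Fin n → Vec m := fun j ↦ x j - η • g j with hl
  have h1 : disagreement (fun i ↦ ∑ j, W i j • l j)
      ≤ ∑ i, ‖∑ j, W i j • (l j - nodeMean l)‖ ^ 2 := by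
    refine (disagreement_le _ (nodeMean l)).trans_eq (Finset.sum_congr rfl fun i _ ↦ ?_)
    simp_rw [smul_sub, Finset.sum_sub_distrib, ← Finset.sum_smul,
      sum_row_of_mem_doublyStochastic hW, one_smul]
  have h2 := sum_norm_sq_mix_le hW hσ (fun j ↦ l j - nodeMean l) (sum_sub_nodeMean l)
  have hmean : nodeMean l = nodeMean x - η • nodeMean g := by
    simp only [nodeMean, hl, Finset.sum_sub_distrib, smul_sub, ← Finset.smul_sum]
    rw [smul_comm]
  have h3 : ∀ j, σ ^ 2 * ‖l j - nodeMean l‖ ^ 2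
      ≤ σ * ‖x j - nodeMean x‖ ^ 2 + σ ^ 2 / (1 - σ) * η ^ 2 * ‖g j - nodeMean g‖ ^ 2 := fun j ↦ by
    have e : l j - nodeMean l = (x j - nodeMean x) - η • (g j - nodeMean g) := by
      rw [hmean, hl]; module
    have n1 := norm_sub_le (x j - nodeMean x) (η • (g j - nodeMean g))
    rw [← e, norm_smul, Real.norm_eq_abs] at n1
    have n2 := pow_le_pow_left₀ (norm_nonneg _) n1 2
    set a := ‖x j - nodeMean x‖
    set c := |η| * ‖g j - nodeMean g‖ with hc
    have hc2 : η ^ 2 * ‖g j - nodeMean g‖ ^ 2 = c ^ 2 := by rw [hc, mul_pow, sq_abs]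
    have young : σ ^ 2 * (a + c) ^ 2 ≤ σ * a ^ 2 + σ ^ 2 / (1 - σ) * c ^ 2 := by
      have : σ * a ^ 2 + σ ^ 2 / (1 - σ) * c ^ 2 - σ ^ 2 * (a + c) ^ 2
          = σ / (1 - σ) * ((1 - σ) * a - σ * c) ^ 2 := by field_simp; ring
      have : 0 ≤ σ / (1 - σ) * ((1 - σ) * a - σ * c) ^ 2 := by positivity
      linarith
    rw [mul_assoc, hc2]
    exact (mul_le_mul_of_nonneg_left n2 (sq_nonneg σ)).trans young
  calc _ ≤ σ ^ 2 * ∑ j, ‖l j - nodeMean l‖ ^ 2 := h1.trans h2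
    _ ≤ ∑ j, (σ * ‖x j - nodeMean x‖ ^ 2
          + σ ^ 2 / (1 - σ) * η ^ 2 * ‖g j - nodeMean g‖ ^ 2) := by
        rw [Finset.mul_sum]; exact Finset.sum_le_sum fun j _ ↦ h3 j
    _ = σ * disagreement x + σ ^ 2 / (1 - σ) * η ^ 2 * disagreement g := by
        rw [Finset.sum_add_distrib, ← Finset.mul_sum, ← Finset.mul_sum]; rfl
    _ ≤ _ := by
        have := disagreement_le g 0
        simp only [sub_zero] at this
        gcongr

/-- Mixing by a doubly stochastic matrix does not increase the total squared distance to a point: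
the rows average, and each column distributes a total weight of `1`. -/
lemma sum_norm_mix_sub_sq_le {n m : ℕ} {W : Matrix (Fin n) (Fin n) ℝ}
    (hW : W ∈ doublyStochastic ℝ (Fin n)) (l : Fin n → Vec m) (y : Vec m) :
    ∑ i, ‖(∑ j, W i j • l j) - y‖ ^ 2 ≤ ∑ j, ‖l j - y‖ ^ 2 := by
  have h : ∀ i, ‖(∑ j, W i j • l j) - y‖ ^ 2 ≤ ∑ j, W i j * ‖l j - y‖ ^ 2 := fun i ↦ by
    have e : (∑ j, W i j • l j) - y = ∑ j, W i j • (l j - y) := by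
      simp_rw [smul_sub, Finset.sum_sub_distrib, ← Finset.sum_smul,
        sum_row_of_mem_doublyStochastic hW, one_smul]
    have hconv : ConvexOn ℝ Set.univ fun v : Vec m ↦ ‖v‖ ^ 2 :=
      (convexOn_univ_norm).pow (fun _ _ ↦ norm_nonneg _) 2
    rw [e]
    simpa using hconv.map_sum_le (t := Finset.univ) (w := W i) (p := fun j ↦ l j - y)
      (fun j _ ↦ nonneg_of_mem_doublyStochastic hW) (sum_row_of_mem_doublyStochastic hW i)
      (fun _ _ ↦ Set.mem_univ _)
  refine (Finset.sum_le_sum fun i _ ↦ h i).trans_eq ?_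
  rw [Finset.sum_comm]
  simp_rw [← Finset.sum_mul, sum_col_of_mem_doublyStochastic hW, one_mul]

/-! ### Moments of the uniform distribution on the sphere -/

open scoped Pointwise in
lemma uniformSphere_map_linearIsometryEquiv {m : ℕ} (L : Vec m ≃ₗᵢ[ℝ] Vec m) :
    (uniformSphere m).map L = uniformSphere m := by
  have hval : Measurable (Subtype.val : Metric.sphere (0 : Vec m) 1 → Vec m) :=
    measurable_subtype_coe
  have hL : Measurable L := L.continuous.measurable
  ext s hs
  have key : Set.Ioo (0 : ℝ) 1 • (Metric.sphere (0 : Vec m) 1 ∩ L ⁻¹' s)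
      = L ⁻¹' (Set.Ioo (0 : ℝ) 1 • (Metric.sphere (0 : Vec m) 1 ∩ s)) := by
    ext x
    simp only [Set.mem_smul, Set.mem_inter_iff, mem_sphere_zero_iff_norm, Set.mem_preimage]
    constructor
    · rintro ⟨r, hr, y, ⟨hy, hys⟩, rfl⟩
      exact ⟨r, hr, L y, ⟨by simpa using hy, hys⟩, by simp⟩
    · rintro ⟨r, hr, y, ⟨hy, hys⟩, hx⟩
      exact ⟨r, hr, L.symm y, ⟨by simpa using hy, by simpa using hys⟩, by
        rw [← map_smul, hx, LinearIsometryEquiv.symm_apply_apply]⟩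
  rw [Measure.map_apply hL hs, uniformSphere, Measure.map_apply hval (hL hs),
    Measure.map_apply hval hs, Measure.smul_apply, Measure.smul_apply,
    Measure.toSphere_apply' _ (hval (hL hs)), Measure.toSphere_apply' _ (hval hs),
    Subtype.image_preimage_coe, Subtype.image_preimage_coe, key]
  congr 2
  exact L.measurePreserving.measure_preimage_equiv (f := L.toHomeomorph.toMeasurableEquiv) _

lemma isProbabilityMeasure_uniformSphere {m : ℕ} (hm : 1 ≤ m) :
    IsProbabilityMeasure (uniformSphere m) := by
  have : Nonempty (Fin m) := ⟨⟨0, hm⟩⟩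
  have : Nontrivial (Vec m) := inferInstance
  refine ⟨?_⟩
  rw [uniformSphere, Measure.map_apply measurable_subtype_coe .univ, Set.preimage_univ,
    Measure.smul_apply, smul_eq_mul]
  exact ENNReal.inv_mul_cancel 
    (Measure.measure_univ_ne_zero.2 (Measure.toSphere_ne_zero _))
    (measure_ne_top _ _)

lemma ae_norm_eq_one_uniformSphere (m : ℕ) : ∀ᵐ u ∂uniformSphere m, ‖u‖ = 1 := by
  rw [uniformSphere, ae_map_iff measurable_subtype_coe.aemeasurable
    (measurableSet_eq_fun measurable_norm measurable_const)]
  exact Filter.Eventually.of_forall fun x ↦ by simp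

lemma integrable_inner_sq_uniformSphere {m : ℕ} (hm : 1 ≤ m) (v : Vec m) :
    Integrable (fun u ↦ (inner ℝ v u : ℝ) ^ 2) (uniformSphere m) := by
  have := isProbabilityMeasure_uniformSphere hm
  refine Integrable.of_bound (C := ‖v‖ ^ 2) (by fun_prop) ?_
  filter_upwards [ae_norm_eq_one_uniformSphere m] with u hu
  rw [norm_pow]
  gcongr
  simpa [hu] using norm_inner_le_norm (𝕜 := ℝ) v u

/-- By invariance under reflections the second moment in a direction `v` depends on `‖v‖` only, and
the second moments in the coordinate directions add up to `1`. -/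
lemma integral_inner_sq_uniformSphere {m : ℕ} (hm : 1 ≤ m) (v : Vec m) :
    ∫ u, (inner ℝ v u : ℝ) ^ 2 ∂uniformSphere m = ‖v‖ ^ 2 / m := by
  have := isProbabilityMeasure_uniformSphere hm
  have hint : ∀ v : Vec m, Integrable (fun u ↦ (inner ℝ v u : ℝ) ^ 2) (uniformSphere m) :=
    integrable_inner_sq_uniformSphere hm
  have hinv : ∀ v w : Vec m, ‖v‖ = ‖w‖ → ∫ u, (inner ℝ v u : ℝ) ^ 2 ∂uniformSphere m
      = ∫ u, (inner ℝ w u : ℝ) ^ 2 ∂uniformSphere m := fun v w hvw ↦ by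
    set L := Submodule.reflection (Submodule.span ℝ {v - w})ᗮ
    have hL : L v = w := Submodule.reflection_sub hvw
    calc ∫ u, (inner ℝ v u : ℝ) ^ 2 ∂uniformSphere m
        = ∫ u, (inner ℝ w (L u) : ℝ) ^ 2 ∂uniformSphere m := by
          simp_rw [← hL, LinearIsometryEquiv.inner_map_map]
      _ = ∫ u, (inner ℝ w u : ℝ) ^ 2 ∂(uniformSphere m).map L :=
          (integral_map L.continuous.aemeasurable
            (by fun_prop : Continuous fun u ↦ (inner ℝ w u : ℝ) ^ 2).aestronglyMeasurable).symm
      _ = _ := by rw [uniformSphere_map_linearIsometryEquiv]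
  set e : Fin m → Vec m := fun k ↦ EuclideanSpace.single k 1 with he
  have hone : ∀ k, ‖e k‖ = 1 := fun k ↦ by simp [he]
  set k₀ : Fin m := ⟨0, hm⟩
  have hsum : (m : ℝ) * ∫ u, (inner ℝ (e k₀) u : ℝ) ^ 2 ∂uniformSphere m = 1 := by
    calc (m : ℝ) * ∫ u, (inner ℝ (e k₀) u : ℝ) ^ 2 ∂uniformSphere m
        = ∑ k, ∫ u, (inner ℝ (e k) u : ℝ) ^ 2 ∂uniformSphere m := by
          rw [Finset.sum_congr rfl fun k _ ↦ hinv (e k) (e k₀) ((hone k).trans (hone k₀).symm)]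
          simp
      _ = ∫ u, ‖u‖ ^ 2 ∂uniformSphere m := by
          rw [← integral_finsetSum _ fun k _ ↦ hint (e k)]
          congr 1 with u
          simp [he, EuclideanSpace.norm_sq_eq, EuclideanSpace.inner_single_left]
      _ = ∫ _, (1 : ℝ) ∂uniformSphere m := by
          refine integral_congr_ae ?_
          filter_upwards [ae_norm_eq_one_uniformSphere m] with u hu
          simp [hu]
      _ = 1 := by simp
  have hm0 : (m : ℝ) ≠ 0 := by positivity
  rw [hinv v (‖v‖ • e k₀) (by simp [norm_smul, hone])]
  simp_rw [real_inner_smul_left, mul_pow]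
  rw [integral_const_mul, eq_div_iff hm0, mul_assoc, mul_comm _ (m : ℝ), hsum, mul_one]

lemma integral_inner_mul_inner_uniformSphere {m : ℕ} (hm : 1 ≤ m) (v w : Vec m) :
    ∫ u, (inner ℝ v u * inner ℝ w u : ℝ) ∂uniformSphere m = inner ℝ v w / m := by
  have := isProbabilityMeasure_uniformSphere hm
  have hint : ∀ v : Vec m, Integrable (fun u ↦ (inner ℝ v u : ℝ) ^ 2) (uniformSphere m) :=
    integrable_inner_sq_uniformSphere hm
  have h : ∀ u : Vec m, (inner ℝ v u * inner ℝ w u : ℝ)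
      = ((inner ℝ (v + w) u) ^ 2 - (inner ℝ (v - w) u) ^ 2) / 4 := fun u ↦ by
    rw [inner_add_left, inner_sub_left]; ring
  simp_rw [h]
  rw [integral_div, integral_sub (hint _) (hint _), integral_inner_sq_uniformSphere hm,
    integral_inner_sq_uniformSphere hm, norm_add_sq_real, norm_sub_sq_real]
  ring

/-! ### One round of the algorithm -/

/-- For a square loss the symmetric difference quotient is exact, whatever the value of `ε ≠ 0`. -/
lemma twoPointGrad_sqLoss {m : ℕ} {ε : ℝ} (hε : ε ≠ 0) (h : Vec m) (z : ℝ) (x u : Vec m) :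
    twoPointGrad ε (sqLoss h z) x u = (m * (inner ℝ h x - z) * inner ℝ h u) • u := by
  rw [twoPointGrad, sqLoss, sqLoss, inner_add_right, inner_sub_right, inner_smul_right]
  congr 1
  field_simp
  ring

lemma continuous_twoPointGrad {m : ℕ} (ε : ℝ) (h : Vec m) (z : ℝ) :
    Continuous fun p : Vec m × Vec m ↦ twoPointGrad ε (sqLoss h z) p.1 p.2 := by
  unfold twoPointGrad sqLoss
  fun_prop

/-- For independent `X` and `U` the expectation of `F (X, U)` may be computed by averaging over `U`
with `X` frozen. -/
lemma integral_comp_of_indepFun {Ω E E' : Type*} [MeasurableSpace Ω] {P : Measure Ω}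
    [IsProbabilityMeasure P] [MeasurableSpace E] [MeasurableSpace E'] {X : Ω → E} {U : Ω → E'}
    (hX : Measurable X) (hU : Measurable U) (hXU : IndepFun X U P) {F : E × E' → ℝ}
    (hF : Measurable F) (hint : Integrable (fun ω ↦ F (X ω, U ω)) P) :
    ∫ ω, F (X ω, U ω) ∂P = ∫ ω, ∫ u, F (X ω, u) ∂(P.map U) ∂P := by
  have := Measure.isProbabilityMeasure_map (μ := P) hX.aemeasurable
  have := Measure.isProbabilityMeasure_map (μ := P) hU.aemeasurable
  have hmap := (indepFun_iff_map_prod_eq_prod_map_map hX.aemeasurable hU.aemeasurable).1 hXU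
  have hXU' : Measurable fun ω ↦ (X ω, U ω) := hX.prodMk hU
  have hint' : Integrable F ((P.map X).prod (P.map U)) := by
    rw [← hmap]
    exact (integrable_map_measure hF.aestronglyMeasurable hXU'.aemeasurable).2 hint
  rw [← integral_map (φ := fun ω ↦ (X ω, U ω)) hXU'.aemeasurable hF.aestronglyMeasurable, hmap,
    integral_prod _ hint', integral_map hX.aemeasurable
      hF.stronglyMeasurable.integral_prod_right'.aestronglyMeasurable]

/-- The randomness of a round: the estimates `X` of the nodes are almost surely bounded,
and the query directions `U` are uniformly distributed on the sphere,
each of them independent of the estimate of its own node. -/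
structure IsRandomRound {n m : ℕ} {Ω : Type*} [MeasurableSpace Ω] (P : Measure Ω)
    (X U : Ω → Fin n → Vec m) : Prop where
  measurable_estimate : Measurable X
  measurable_direction : Measurable U
  bounded : ∀ j, ∃ B : ℝ, ∀ᵐ ω ∂P, ‖X ω j‖ ≤ B
  law : ∀ j, P.map (fun ω ↦ U ω j) = uniformSphere m
  indep : ∀ j, IndepFun (fun ω ↦ X ω j) (fun ω ↦ U ω j) P

section Round

variable {n m : ℕ} {Ω : Type*} [MeasurableSpace Ω] {P : Measure Ω}
  {X U : Ω → Fin n → Vec m}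

lemma IsRandomRound.ae_norm_direction (H : IsRandomRound P X U) (j : Fin n) :
    ∀ᵐ ω ∂P, ‖U ω j‖ = 1 := by
  have hU : Measurable fun ω ↦ U ω j := (measurable_pi_apply j).comp H.measurable_direction
  have := ae_norm_eq_one_uniformSphere m
  rw [← H.law j] at this
  exact ae_of_ae_map hU.aemeasurable this

/-- The expected total squared residual of the estimates. -/
noncomputable def residualEnergy (P : Measure Ω) (h : Fin n → Vec m) (z : Fin n → ℝ)
    (X : Ω → Fin n → Vec m) : ℝ :=
  ∫ ω, ∑ j, (inner ℝ (h j) (X ω j) - z j) ^ 2 ∂P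

lemma residualEnergy_nonneg (h : Fin n → Vec m) (z : Fin n → ℝ) (X : Ω → Fin n → Vec m) :
    0 ≤ residualEnergy P h z X :=
  integral_nonneg fun _ ↦ Finset.sum_nonneg fun _ _ ↦ sq_nonneg _

lemma IsRandomRound.ae_norm_le (H : IsRandomRound P X U) :
    ∃ B : ℝ, ∀ᵐ ω ∂P, ‖(X ω, U ω)‖ ≤ B := by
  choose B hB using H.bounded
  refine ⟨max 1 (∑ j, |B j|), ?_⟩
  filter_upwards [ae_all_iff.2 hB, ae_all_iff.2 H.ae_norm_direction] with ω hω₁ hω₂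
  refine max_le ?_ ?_
  · refine le_max_of_le_right ((pi_norm_le_iff_of_nonneg (by positivity)).2 fun j ↦ ?_)
    exact ((hω₁ j).trans (le_abs_self _)).trans
      (Finset.single_le_sum (f := fun j ↦ |B j|) (fun _ _ ↦ abs_nonneg _) (Finset.mem_univ j))
  · exact le_max_of_le_left
      ((pi_norm_le_iff_of_nonneg zero_le_one).2 fun j ↦ (hω₂ j).le)

lemma IsRandomRound.ae_norm_comp_le (H : IsRandomRound P X U) {E : Type*} [NormedAddCommGroup E]
    {F : (Fin n → Vec m) × (Fin n → Vec m) → E} (hF : Continuous F) :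
    ∃ C : ℝ, ∀ᵐ ω ∂P, ‖F (X ω, U ω)‖ ≤ C := by
  obtain ⟨B, hB⟩ := H.ae_norm_le
  obtain ⟨C, hC⟩ := (isCompact_closedBall (0 : (Fin n → Vec m) × (Fin n → Vec m))
    B).exists_bound_of_continuousOn hF.continuousOn
  refine ⟨C, ?_⟩
  filter_upwards [hB] with ω hω
  exact hC _ (by simpa using hω)

variable [IsProbabilityMeasure P]

/-- Continuous functions of the estimates and the query directions are bounded, so integrable. -/
lemma IsRandomRound.integrable (H : IsRandomRound P X U)
    {F : (Fin n → Vec m) × (Fin n → Vec m) → ℝ} (hF : Continuous F) :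
    Integrable (fun ω ↦ F (X ω, U ω)) P := by
  obtain ⟨C, hC⟩ := H.ae_norm_comp_le hF
  exact Integrable.of_bound (hF.measurable.comp
    (H.measurable_estimate.prodMk H.measurable_direction)).aestronglyMeasurable C hC

/-- The estimator is unbiased: in expectation it may be replaced by the gradient
`(hᵀ x - z) h` of the loss. -/
lemma IsRandomRound.integral_inner_twoPointGrad (H : IsRandomRound P X U) (hm : 1 ≤ m) {ε : ℝ}
    (hε : ε ≠ 0) (h : Vec m) (z : ℝ) (y : Vec m) (j : Fin n) :
    ∫ ω, inner ℝ (twoPointGrad ε (sqLoss h z) (X ω j) (U ω j)) (X ω j - y) ∂P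
      = ∫ ω, (inner ℝ h (X ω j) - z) * inner ℝ h (X ω j - y) ∂P := by
  have hcont := continuous_twoPointGrad ε h z
  have hF : Continuous fun p : Vec m × Vec m ↦
      (inner ℝ (twoPointGrad ε (sqLoss h z) p.1 p.2) (p.1 - y) : ℝ) := by fun_prop
  have hint := H.integrable (F := fun q ↦
    inner ℝ (twoPointGrad ε (sqLoss h z) (q.1 j) (q.2 j)) (q.1 j - y))
    (hF.comp (f := fun q : (Fin n → Vec m) × (Fin n → Vec m) ↦ (q.1 j, q.2 j)) (by fun_prop))
  refine (integral_comp_of_indepFun (X := fun ω ↦ X ω j) (U := fun ω ↦ U ω j)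
    (F := fun p ↦ inner ℝ (twoPointGrad ε (sqLoss h z) p.1 p.2) (p.1 - y))
    ((measurable_pi_apply j).comp H.measurable_estimate)
    ((measurable_pi_apply j).comp H.measurable_direction) (H.indep j) hF.measurable hint).trans ?_
  rw [H.law j]
  congr 1 with ω
  have e : ∀ u, (inner ℝ (twoPointGrad ε (sqLoss h z) (X ω j) u) (X ω j - y) : ℝ)
      = m * (inner ℝ h (X ω j) - z) * (inner ℝ h u * inner ℝ (X ω j - y) u) := fun u ↦ by
    rw [twoPointGrad_sqLoss hε, real_inner_smul_left, real_inner_comm (X ω j - y) u]; ring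
  simp_rw [e]
  rw [integral_const_mul, integral_inner_mul_inner_uniformSphere hm]
  have : (m : ℝ) ≠ 0 := by positivity
  field_simp

lemma IsRandomRound.integral_norm_twoPointGrad_sq (H : IsRandomRound P X U) (hm : 1 ≤ m) {ε : ℝ}
    (hε : ε ≠ 0) (h : Vec m) (z : ℝ) (j : Fin n) :
    ∫ ω, ‖twoPointGrad ε (sqLoss h z) (X ω j) (U ω j)‖ ^ 2 ∂P
      = m * ‖h‖ ^ 2 * ∫ ω, (inner ℝ h (X ω j) - z) ^ 2 ∂P := by
  have hcont := continuous_twoPointGrad ε h z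
  have hF : Continuous fun p : Vec m × Vec m ↦ ‖twoPointGrad ε (sqLoss h z) p.1 p.2‖ ^ 2 := by
    fun_prop
  have hint := H.integrable (F := fun q ↦ ‖twoPointGrad ε (sqLoss h z) (q.1 j) (q.2 j)‖ ^ 2)
    (hF.comp (f := fun q : (Fin n → Vec m) × (Fin n → Vec m) ↦ (q.1 j, q.2 j)) (by fun_prop))
  refine (integral_comp_of_indepFun (X := fun ω ↦ X ω j) (U := fun ω ↦ U ω j)
    (F := fun p ↦ ‖twoPointGrad ε (sqLoss h z) p.1 p.2‖ ^ 2)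
    ((measurable_pi_apply j).comp H.measurable_estimate)
    ((measurable_pi_apply j).comp H.measurable_direction) (H.indep j) hF.measurable hint).trans ?_
  rw [H.law j, ← integral_const_mul]
  congr 1 with ω
  calc ∫ u, ‖twoPointGrad ε (sqLoss h z) (X ω j) u‖ ^ 2 ∂uniformSphere m
      = ∫ u, (m * (inner ℝ h (X ω j) - z)) ^ 2 * (inner ℝ h u : ℝ) ^ 2 ∂uniformSphere m := by
        refine integral_congr_ae ?_
        filter_upwards [ae_norm_eq_one_uniformSphere m] with u hu
        rw [twoPointGrad_sqLoss hε, norm_smul, hu, mul_one, Real.norm_eq_abs, sq_abs, mul_pow]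
    _ = _ := by
        rw [integral_const_mul, integral_inner_sq_uniformSphere hm]
        have : (m : ℝ) ≠ 0 := by positivity
        field_simp

lemma IsRandomRound.integral_sum_norm_twoPointGrad_sq_le (H : IsRandomRound P X U) (hm : 1 ≤ m)
    {ε α : ℝ} (hε : ε ≠ 0) {h : Fin n → Vec m} (hh : ∀ j, ‖h j‖ ^ 2 ≤ α) (z : Fin n → ℝ) :
    ∫ ω, ∑ j, ‖twoPointGrad ε (sqLoss (h j) (z j)) (X ω j) (U ω j)‖ ^ 2 ∂P
      ≤ m * α * residualEnergy P h z X := by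
  have hcont := fun j ↦ continuous_twoPointGrad ε (h j) (z j)
  rw [residualEnergy, integral_finsetSum, integral_finsetSum, Finset.mul_sum]
  · refine Finset.sum_le_sum fun j _ ↦ ?_
    rw [H.integral_norm_twoPointGrad_sq hm hε]
    have : 0 ≤ ∫ ω, (inner ℝ (h j) (X ω j) - z j : ℝ) ^ 2 ∂P := integral_nonneg fun _ ↦ sq_nonneg _
    gcongr
    exact hh j
  · exact fun j _ ↦ H.integrable (F := fun q ↦ (inner ℝ (h j) (q.1 j) - z j) ^ 2) (by fun_prop)
  · exact fun j _ ↦ H.integrable (F := fun q ↦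
      ‖twoPointGrad ε (sqLoss (h j) (z j)) (q.1 j) (q.2 j)‖ ^ 2)
      (((hcont j).comp (f := fun q : (Fin n → Vec m) × (Fin n → Vec m) ↦ (q.1 j, q.2 j))
        (by fun_prop)).norm.pow 2)

/-- The estimates after a round with step size `η`: a gradient step with the two-point estimator at
every node, followed by mixing. -/
noncomputable def nextEstimate (W : Matrix (Fin n) (Fin n) ℝ) (ε η : ℝ) (h : Fin n → Vec m)
    (z : Fin n → ℝ) (x u : Fin n → Vec m) (i : Fin n) : Vec m :=
  ∑ j, W i j • (x j - η • twoPointGrad ε (sqLoss (h j) (z j)) (x j) (u j))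

lemma continuous_nextEstimate (W : Matrix (Fin n) (Fin n) ℝ) (ε η : ℝ) (h : Fin n → Vec m)
    (z : Fin n → ℝ) : Continuous fun q : (Fin n → Vec m) × (Fin n → Vec m) ↦
      nextEstimate W ε η h z q.1 q.2 := by
  refine continuous_pi fun i ↦ ?_
  unfold nextEstimate
  have hg : ∀ j, Continuous fun q : (Fin n → Vec m) × (Fin n → Vec m) ↦
      twoPointGrad ε (sqLoss (h j) (z j)) (q.1 j) (q.2 j) := fun j ↦
    (continuous_twoPointGrad ε (h j) (z j)).comp
      (f := fun q : (Fin n → Vec m) × (Fin n → Vec m) ↦ (q.1 j, q.2 j)) (by fun_prop)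
  fun_prop

lemma continuous_disagreement : Continuous (disagreement : (Fin n → Vec m) → ℝ) := by
  unfold disagreement nodeMean
  fun_prop

/-- Descent of the expected distance to a fixed predictor `y`. With residuals `r` of the
estimates and `s` of `y`, the first-order term is `-2 η r (r - s) ≤ -η (r² - s²)`. -/
lemma IsRandomRound.integral_dist_nextEstimate_le (H : IsRandomRound P X U) (hm : 1 ≤ m)
    {W : Matrix (Fin n) (Fin n) ℝ} (hW : W ∈ doublyStochastic ℝ (Fin n)) {ε η α : ℝ} (hε : ε ≠ 0)
    (hη : 0 ≤ η) {h : Fin n → Vec m} (hh : ∀ j, ‖h j‖ ^ 2 ≤ α) (z : Fin n → ℝ) (y : Vec m) :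
    ∫ ω, ∑ i, ‖nextEstimate W ε η h z (X ω) (U ω) i - y‖ ^ 2 ∂P
      ≤ ∫ ω, ∑ i, ‖X ω i - y‖ ^ 2 ∂P
        - η * (residualEnergy P h z X - ∑ j, (inner ℝ (h j) y - z j) ^ 2)
        + η ^ 2 * (m * α * residualEnergy P h z X) := by
  set g : (Fin n → Vec m) × (Fin n → Vec m) → Fin n → Vec m := fun q j ↦
    twoPointGrad ε (sqLoss (h j) (z j)) (q.1 j) (q.2 j) with hg
  have hgc : ∀ j, Continuous fun q ↦ g q j := fun j ↦
    (continuous_twoPointGrad ε (h j) (z j)).comp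
      (f := fun q : (Fin n → Vec m) × (Fin n → Vec m) ↦ (q.1 j, q.2 j)) (by fun_prop)
  have hnext := continuous_nextEstimate W ε η h z
  have hnext' : ∀ i, Continuous fun q : (Fin n → Vec m) × (Fin n → Vec m) ↦
      nextEstimate W ε η h z q.1 q.2 i := fun i ↦ (continuous_apply i).comp hnext
  have i0 := H.integrable (F := fun q ↦ ∑ i, ‖nextEstimate W ε η h z q.1 q.2 i - y‖ ^ 2)
    (by fun_prop)
  have i1 := H.integrable (F := fun q ↦ ∑ i, ‖q.1 i - y‖ ^ 2) (by fun_prop)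
  have i2 := H.integrable (F := fun q ↦ ∑ j, inner ℝ (g q j) (q.1 j - y)) (by fun_prop)
  have i2' := fun j ↦ H.integrable (F := fun q ↦ inner ℝ (g q j) (q.1 j - y)) (by fun_prop)
  have i3 := H.integrable (F := fun q ↦ ∑ j, ‖g q j‖ ^ 2) (by fun_prop)
  have i4 := H.integrable (F := fun q ↦ ∑ j, (inner ℝ (h j) (q.1 j) - z j) ^ 2) (by fun_prop)
  have i5 := H.integrable (F := fun q ↦
    ∑ j, (inner ℝ (h j) (q.1 j) - z j) * inner ℝ (h j) (q.1 j - y)) (by fun_prop)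
  have i5' := fun j ↦ H.integrable (F := fun q ↦
    (inner ℝ (h j) (q.1 j) - z j) * inner ℝ (h j) (q.1 j - y)) (by fun_prop)
  have step1 : ∫ ω, ∑ i, ‖nextEstimate W ε η h z (X ω) (U ω) i - y‖ ^ 2 ∂P
      ≤ ∫ ω, ∑ i, ‖X ω i - y‖ ^ 2 ∂P - 2 * η * ∫ ω, ∑ j, inner ℝ (g (X ω, U ω) j) (X ω j - y) ∂P
        + η ^ 2 * ∫ ω, ∑ j, ‖g (X ω, U ω) j‖ ^ 2 ∂P := by
    have i12 : Integrable (fun ω ↦ ∑ i, ‖X ω i - y‖ ^ 2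
        - 2 * η * ∑ j, inner ℝ (g (X ω, U ω) j) (X ω j - y)) P := i1.sub (i2.const_mul _)
    rw [← integral_const_mul, ← integral_const_mul, ← integral_sub i1 (i2.const_mul _),
      ← integral_add i12 (i3.const_mul _)]
    refine integral_mono i0 (i12.add (i3.const_mul _)) fun ω ↦ ?_
    refine (sum_norm_mix_sub_sq_le hW _ y).trans_eq ?_
    simp only [Finset.mul_sum]
    rw [← Finset.sum_sub_distrib, ← Finset.sum_add_distrib]
    refine Finset.sum_congr rfl fun j _ ↦ ?_
    rw [sub_right_comm, norm_sub_sq_real, norm_smul, mul_pow, Real.norm_eq_abs, sq_abs,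
      real_inner_smul_right, real_inner_comm]
    ring
  have step2 : ∫ ω, ∑ j, inner ℝ (g (X ω, U ω) j) (X ω j - y) ∂P
      = ∫ ω, ∑ j, (inner ℝ (h j) (X ω j) - z j) * inner ℝ (h j) (X ω j - y) ∂P := by
    rw [integral_finsetSum _ fun j _ ↦ i2' j, integral_finsetSum _ fun j _ ↦ i5' j]
    exact Finset.sum_congr rfl fun j _ ↦ H.integral_inner_twoPointGrad hm hε (h j) (z j) y j
  have step3 : residualEnergy P h z X - ∑ j, (inner ℝ (h j) y - z j) ^ 2
      ≤ 2 * ∫ ω, ∑ j, (inner ℝ (h j) (X ω j) - z j) * inner ℝ (h j) (X ω j - y) ∂P := by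
    have hc : ∑ j, (inner ℝ (h j) y - z j) ^ 2
        = ∫ _, ∑ j, (inner ℝ (h j) y - z j) ^ 2 ∂P := by simp
    rw [residualEnergy, hc, ← integral_sub i4 (integrable_const _), ← integral_const_mul]
    refine integral_mono (i4.sub (integrable_const _)) (i5.const_mul _) fun ω ↦ ?_
    simp only [Finset.mul_sum]
    rw [← Finset.sum_sub_distrib]
    refine Finset.sum_le_sum fun j _ ↦ ?_
    rw [inner_sub_right]
    nlinarith [sq_nonneg ((inner ℝ (h j) (X ω j) : ℝ) - inner ℝ (h j) y)]
  have step4 : ∫ ω, ∑ j, ‖g (X ω, U ω) j‖ ^ 2 ∂P ≤ m * α * residualEnergy P h z X :=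
    H.integral_sum_norm_twoPointGrad_sq_le hm hε hh z
  have := mul_le_mul_of_nonneg_left step3 hη
  have := mul_le_mul_of_nonneg_left step4 (sq_nonneg η)
  rw [step2] at step1
  linarith

lemma IsRandomRound.integral_disagreement_nextEstimate_le (H : IsRandomRound P X U) (hm : 1 ≤ m)
    {W : Matrix (Fin n) (Fin n) ℝ} (hW : W ∈ doublyStochastic ℝ (Fin n)) (hσ : sigmaTwo W < 1)
    {ε α : ℝ} (hε : ε ≠ 0) (η : ℝ) {h : Fin n → Vec m} (hh : ∀ j, ‖h j‖ ^ 2 ≤ α) (z : Fin n → ℝ) :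
    ∫ ω, disagreement (nextEstimate W ε η h z (X ω) (U ω)) ∂P
      ≤ sigmaTwo W * ∫ ω, disagreement (X ω) ∂P
        + sigmaTwo W ^ 2 / (1 - sigmaTwo W) * η ^ 2 * (m * α * residualEnergy P h z X) := by
  have hgc : ∀ j, Continuous fun q : (Fin n → Vec m) × (Fin n → Vec m) ↦
      twoPointGrad ε (sqLoss (h j) (z j)) (q.1 j) (q.2 j) := fun j ↦
    (continuous_twoPointGrad ε (h j) (z j)).comp
      (f := fun q : (Fin n → Vec m) × (Fin n → Vec m) ↦ (q.1 j, q.2 j)) (by fun_prop)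
  have i0 := H.integrable (continuous_disagreement.comp (continuous_nextEstimate W ε η h z))
  have i1 := H.integrable (F := fun q ↦ disagreement q.1)
    (continuous_disagreement.comp continuous_fst)
  have i2 := H.integrable (F := fun q ↦
    ∑ j, ‖twoPointGrad ε (sqLoss (h j) (z j)) (q.1 j) (q.2 j)‖ ^ 2) (by fun_prop)
  have hpos : 0 ≤ sigmaTwo W ^ 2 / (1 - sigmaTwo W) * η ^ 2 :=
    mul_nonneg (div_nonneg (sq_nonneg _) (by linarith)) (sq_nonneg _)
  refine le_trans ?_ (add_le_add_right (mul_le_mul_of_nonneg_left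
    (H.integral_sum_norm_twoPointGrad_sq_le hm hε hh z) hpos) _)
  rw [← integral_const_mul, ← integral_const_mul,
    ← integral_add (i1.const_mul _) (i2.const_mul _)]
  exact integral_mono i0 ((i1.const_mul _).add (i2.const_mul _)) fun ω ↦
    disagreement_mix_le hW hσ (X ω) _ η

/-- The expected losses of all nodes at the estimate of node `i`: the change from the
estimate of node `j` to that of node `i` is split off by Young's inequality with parameter
`μ ≤ 1`, and paid for by the disagreement. -/
lemma IsRandomRound.integral_sum_sqLoss_le (H : IsRandomRound P X U) {α μ : ℝ} (hα : 0 ≤ α)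
    (hμ : 0 < μ) (hμ1 : μ ≤ 1) {h : Fin n → Vec m} (hh : ∀ j, ‖h j‖ ^ 2 ≤ α) (z : Fin n → ℝ)
    (i : Fin n) :
    ∑ j, ∫ ω, sqLoss (h j) (z j) (X ω i) ∂P
      ≤ (1 / 2 + μ / 2) * residualEnergy P h z X
        + 4 * n * α / μ * ∫ ω, disagreement (X ω) ∂P := by
  have i0 := fun j ↦ H.integrable (F := fun q ↦ sqLoss (h j) (z j) (q.1 i))
    (by unfold sqLoss; fun_prop)
  have i1 := H.integrable (F := fun q ↦ disagreement q.1)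
    (continuous_disagreement.comp continuous_fst)
  have i2 := H.integrable (F := fun q ↦ ∑ j, (inner ℝ (h j) (q.1 j) - z j) ^ 2) (by fun_prop)
  rw [← integral_finsetSum _ fun j _ ↦ i0 j, residualEnergy, ← integral_const_mul,
    ← integral_const_mul, ← integral_add (i2.const_mul _) (i1.const_mul _)]
  refine integral_mono (integrable_finsetSum _ fun j _ ↦ i0 j)
    ((i2.const_mul _).add (i1.const_mul _)) fun ω ↦ ?_
  have hj : ∀ j, sqLoss (h j) (z j) (X ω i) ≤ (1 / 2 + μ / 2) * (inner ℝ (h j) (X ω j) - z j) ^ 2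
      + α / μ * ‖X ω i - X ω j‖ ^ 2 := fun j ↦ by
    set r : ℝ := inner ℝ (h j) (X ω j) - z j
    set d : ℝ := inner ℝ (h j) (X ω i - X ω j) with hd
    have e : (inner ℝ (h j) (X ω i) : ℝ) - z j = r + d := by
      simp only [r, hd, inner_sub_right]; ring
    have hd2 : d ^ 2 ≤ α * ‖X ω i - X ω j‖ ^ 2 := by
      have h1 := abs_real_inner_le_norm (h j) (X ω i - X ω j)
      have h2 := pow_le_pow_left₀ (abs_nonneg _) h1 2
      rw [sq_abs, mul_pow] at h2
      exact h2.trans (mul_le_mul_of_nonneg_right (hh j) (sq_nonneg _))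
    have h3 : (1 / 2) * (r + d) ^ 2 ≤ (1 / 2 + μ / 2) * r ^ 2 + 1 / μ * d ^ 2 := by
      have : (1 / 2 + μ / 2) * r ^ 2 + 1 / μ * d ^ 2 - (1 / 2) * (r + d) ^ 2
          = 1 / (2 * μ) * ((μ * r - d) ^ 2 + (1 - μ) * d ^ 2) := by field_simp; ring
      have : 0 ≤ 1 / (2 * μ) * ((μ * r - d) ^ 2 + (1 - μ) * d ^ 2) := by
        have := sub_nonneg.2 hμ1
        positivity
      linarith
    have h4 : 1 / μ * d ^ 2 ≤ α / μ * ‖X ω i - X ω j‖ ^ 2 := by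
      rw [one_div_mul_eq_div, div_mul_eq_mul_div]
      gcongr
    rw [sqLoss, e]
    linarith
  calc ∑ j, sqLoss (h j) (z j) (X ω i)
      ≤ ∑ j, ((1 / 2 + μ / 2) * (inner ℝ (h j) (X ω j) - z j) ^ 2
          + α / μ * ‖X ω i - X ω j‖ ^ 2) := Finset.sum_le_sum fun j _ ↦ hj j
    _ = (1 / 2 + μ / 2) * ∑ j, (inner ℝ (h j) (X ω j) - z j : ℝ) ^ 2
          + α / μ * ∑ j, ‖X ω i - X ω j‖ ^ 2 := by
        rw [Finset.sum_add_distrib, ← Finset.mul_sum, ← Finset.mul_sum]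
    _ ≤ (1 / 2 + μ / 2) * ∑ j, (inner ℝ (h j) (X ω j) - z j : ℝ) ^ 2
          + α / μ * (4 * n * disagreement (X ω)) := by
        gcongr
        exact sum_norm_sub_sq_le _ i
    _ = _ := by ring

end Round

/-! ### The iterates as random variables -/

lemma dolrBF_succ {n m : ℕ} {G : Digraph (Fin n)} {W : Matrix (Fin n) (Fin n) ℝ}
    (hnet : IsNetwork G W) (h : Fin n → ℕ → Vec m) (z : Fin n → ℕ → ℝ) (T : ℕ) (β ε κ : ℝ)
    (x₁ : Fin n → Vec m) (u : Fin n → ℕ → Vec m) (t : ℕ) :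
    dolrBF G W h z T β ε κ x₁ u (t + 1) =
      nextEstimate W ε (1 / (κ * (T : ℝ) ^ β)) (fun j ↦ h j t) (fun j ↦ z j t)
        (dolrBF G W h z T β ε κ x₁ u t) (fun j ↦ u j t) := by
  classical
  funext i
  simp only [dolrBF, nextEstimate, localStep]
  rw [← Finset.add_sum_erase _ _ (Finset.mem_univ i)]
  congr 1
  refine Finset.sum_subset (fun j hj ↦ ?_) fun j hj hj' ↦ ?_
  · simp only [inNbrs, Finset.mem_filter] at hj
    exact Finset.mem_erase.2 ⟨hj.2.1, Finset.mem_univ j⟩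
  · have hij : j ≠ i := Finset.ne_of_mem_erase hj
    have hW : W i j = 0 := by
      refine le_antisymm (not_lt.1 fun hpos ↦ hj' ?_)
        (nonneg_of_mem_doublyStochastic hnet.stochastic)
      simp only [inNbrs, Finset.mem_filter]
      exact ⟨Finset.mem_univ j, hij, (hnet.support i j hij.symm).1 hpos⟩
    rw [hW, zero_smul]

/-- The σ-algebra of the query directions of the rounds before `t`. -/
abbrev pastDirections {n m T : ℕ} {Ω : Type*} (u : Fin n → ℕ → Ω → Vec m) (t : ℕ) :
    MeasurableSpace Ω :=
  ⨆ p ∈ {p : Fin n × Fin T | (p.2 : ℕ) < t}, MeasurableSpace.comap (u p.1 p.2) inferInstance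

lemma measurable_nextEstimate_comp {n m : ℕ} {Ω : Type*} {mΩ : MeasurableSpace Ω}
    (W : Matrix (Fin n) (Fin n) ℝ) (ε η : ℝ) (h : Fin n → Vec m) (z : Fin n → ℝ)
    {X U : Ω → Fin n → Vec m} (hX : Measurable X) (hU : Measurable U) :
    Measurable fun ω ↦ nextEstimate W ε η h z (X ω) (U ω) :=
  measurable_pi_iff.2 fun i ↦
    ((continuous_apply i).comp (continuous_nextEstimate W ε η h z)).measurable.comp (hX.prodMk hU)

section Iterates

variable {n m T : ℕ} {Ω : Type*} [MeasurableSpace Ω] {P : Measure Ω} {u : Fin n → ℕ → Ω → Vec m}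

lemma IsUniformDirections.isRandomRound (hu : IsUniformDirections P T u) {t : ℕ} (ht : t < T)
    {X : Ω → Fin n → Vec m} (hX : Measurable[pastDirections (T := T) u t] X)
    (hb : ∀ j, ∃ B : ℝ, ∀ᵐ ω ∂P, ‖X ω j‖ ≤ B) : IsRandomRound P X (fun ω j ↦ u j t ω) where
  measurable_estimate := hX.mono
    (iSup₂_le fun p _ ↦ (hu.measurable p.1 p.2 p.2.isLt).comap_le) le_rfl
  measurable_direction := measurable_pi_iff.2 fun j ↦ hu.measurable j t ht
  bounded := hb
  law j := hu.law j t ht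
  indep j := by
    have hdisj : Disjoint {p : Fin n × Fin T | (p.2 : ℕ) < t} {(j, ⟨t, ht⟩)} := by simp
    have hind := indep_iSup_of_disjoint
      (fun p : Fin n × Fin T ↦ (hu.measurable p.1 p.2 p.2.isLt).comap_le) hu.indep.iIndep hdisj
    rw [IndepFun_iff_Indep]
    refine indep_of_indep_of_le_left (indep_of_indep_of_le_right hind ?_)
      ((measurable_pi_apply j).comp hX).comap_le
    exact le_iSup₂ (f := fun (p : Fin n × Fin T) (_ : p ∈ {(j, (⟨t, ht⟩ : Fin T))}) ↦
      MeasurableSpace.comap (u p.1 p.2) inferInstance) (j, ⟨t, ht⟩) rfl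

/-- The estimates of a round depend on the query directions of the earlier rounds only, and are
bounded. -/
lemma IsUniformDirections.measurable_and_bounded_dolrBF (hu : IsUniformDirections P T u)
    {G : Digraph (Fin n)} {W : Matrix (Fin n) (Fin n) ℝ} (hnet : IsNetwork G W)
    (h : Fin n → ℕ → Vec m) (z : Fin n → ℕ → ℝ) (β ε κ : ℝ) (x₁ : Fin n → Vec m) {t : ℕ}
    (ht : t ≤ T) :
    Measurable[pastDirections (T := T) u t]
        (fun ω ↦ dolrBF G W h z T β ε κ x₁ (fun j s ↦ u j s ω) t) ∧
      ∀ j, ∃ B : ℝ, ∀ᵐ ω ∂P, ‖dolrBF G W h z T β ε κ x₁ (fun j s ↦ u j s ω) t j‖ ≤ B := by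
  induction t with
  | zero =>
    exact ⟨measurable_const, fun j ↦ ⟨‖x₁ j‖, Filter.Eventually.of_forall fun _ ↦ le_rfl⟩⟩
  | succ t ih =>
    obtain ⟨hm, hb⟩ := ih (by omega)
    have ht' : t < T := ht
    simp_rw [dolrBF_succ hnet]
    have hcont := continuous_nextEstimate W ε (1 / (κ * (T : ℝ) ^ β)) (fun j ↦ h j t)
      (fun j ↦ z j t)
    constructor
    · have hpast : pastDirections (T := T) u t ≤ pastDirections (T := T) u (t + 1) :=
        biSup_mono fun p hp ↦ Nat.lt_succ_of_lt hp
      have hu' : Measurable[pastDirections (T := T) u (t + 1)] fun ω j ↦ u j t ω := by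
        refine @measurable_pi_iff _ _ _ (pastDirections (T := T) u (t + 1)) _ _ |>.2 fun j ↦ ?_
        refine (comap_measurable (u j t)).mono ?_ le_rfl
        exact le_iSup₂ (f := fun (p : Fin n × Fin T) (_ : p ∈ {p : Fin n × Fin T |
          (p.2 : ℕ) < t + 1}) ↦ MeasurableSpace.comap (u p.1 p.2) inferInstance)
          (j, ⟨t, ht'⟩) (Nat.lt_succ_self t)
      exact measurable_nextEstimate_comp _ _ _ _ _ (hm.mono hpast le_rfl) hu'
    · exact fun j ↦ (hu.isRandomRound ht' hm hb).ae_norm_comp_le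
        (F := fun q ↦ nextEstimate W ε (1 / (κ * (T : ℝ) ^ β)) (fun j ↦ h j t)
          (fun j ↦ z j t) q.1 q.2 j) ((continuous_apply j).comp hcont)

lemma IsUniformDirections.isRandomRound_dolrBFProcess (hu : IsUniformDirections P T u)
    {G : Digraph (Fin n)} {W : Matrix (Fin n) (Fin n) ℝ} (hnet : IsNetwork G W)
    (h : Fin n → ℕ → Vec m) (z : Fin n → ℕ → ℝ) (β ε κ : ℝ) (x₁ : Fin n → Vec m) {t : ℕ}
    (ht : t < T) :
    IsRandomRound P (fun ω i ↦ dolrBFProcess G W h z T β ε κ x₁ u t i ω) (fun ω j ↦ u j t ω) :=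
  have hx := hu.measurable_and_bounded_dolrBF hnet h z β ε κ x₁ ht.le
  hu.isRandomRound ht hx.1 hx.2

end Iterates

/-! ### Summation over the rounds -/

lemma add_sum_range_le {a b c : ℕ → ℝ} {T : ℕ} (h : ∀ t < T, a (t + 1) + b t ≤ a t + c t) :
    a T + ∑ t ∈ Finset.range T, b t ≤ a 0 + ∑ t ∈ Finset.range T, c t := by
  induction T with
  | zero => simp
  | succ T ih =>
    rw [Finset.sum_range_succ, Finset.sum_range_succ]
    linarith [ih fun t ht ↦ h t (by omega), h T (by omega)]

lemma regret_coefficients_le {α θ D n m κ : ℝ} (hα : 0 < α) (hD : 0 ≤ D) (hn : 1 ≤ n) (hm : 1 ≤ m)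
    (hκ : 0 ≤ κ) (q : ℝ) :
    2 * κ * D + 3 / 2 * (n * θ ^ 2)
      + (8 * α * n * D + q ^ 2 * (8 * α * n * D + 2 * θ ^ 2 * n ^ 2))
      ≤ (8 * α + 2 * θ ^ 2 + 2) * (q ^ 2 *
        (n ^ 5 * m ^ 2 + n ^ 4 * m ^ 4 + n ^ 3 * m ^ 2 * D) + (n + (n + κ) * D)) := by
  have hn2 : n ≤ n ^ 3 * m ^ 2 := by
    calc n = n ^ 1 * 1 := by ring
      _ ≤ n ^ 3 * m ^ 2 := mul_le_mul (pow_le_pow_right₀ hn (by norm_num)) (one_le_pow₀ hm)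
        zero_le_one (by positivity)
  have hn5 : n ^ 2 ≤ n ^ 5 * m ^ 2 := by
    calc n ^ 2 = n ^ 2 * 1 := by ring
      _ ≤ n ^ 5 * m ^ 2 := mul_le_mul (pow_le_pow_right₀ hn (by norm_num)) (one_le_pow₀ hm)
        zero_le_one (by positivity)
  set C := 8 * α + 2 * θ ^ 2 + 2 with hC
  have c1 : 2 ≤ C := by nlinarith [sq_nonneg θ]
  have c2 : 8 * α ≤ C := by nlinarith [sq_nonneg θ]
  have c3 : 2 * θ ^ 2 ≤ C := by nlinarith [sq_nonneg θ]
  have e1 : 2 * (κ * D) ≤ C * (κ * D) := by gcongr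
  have e2 : 2 * θ ^ 2 * n ≤ C * n := by gcongr
  have e3 : 8 * α * (n * D) ≤ C * (n * D) := by gcongr
  have e4 : 8 * α * (n * D) ≤ C * (n ^ 3 * m ^ 2 * D) := by gcongr
  have e5 : 2 * θ ^ 2 * n ^ 2 ≤ C * (n ^ 5 * m ^ 2) := by gcongr
  have e6 : 0 ≤ C * (n ^ 4 * m ^ 4) := by positivity
  have e7 : 0 ≤ n * θ ^ 2 := by positivity
  have e8 : q ^ 2 * (8 * α * n * D + 2 * θ ^ 2 * n ^ 2)
      ≤ q ^ 2 * (C * (n ^ 5 * m ^ 2 + n ^ 4 * m ^ 4 + n ^ 3 * m ^ 2 * D)) := by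
    gcongr
    linarith
  linarith

/-- The regret bound from the summed recursions, where `ρ` and `s` are the total squared residuals
of the estimates and of the fixed predictor, `a` is the total disagreement, and
`Q = T^{1/4}`, `S = T^{3/4}`. -/
lemma regret_arith {α θ D σ n m κ Q S ρ s a : ℝ} (hα : 0 < α) (hD : 0 ≤ D)
    (hσ0 : 0 ≤ σ) (hσ1 : σ < 1) (hn : 1 ≤ n) (hm : 1 ≤ m) (hκ : 2 * m ^ 2 * α ≤ κ) (hQ : 1 ≤ Q)
    (hQS : Q ≤ S) (hρ : 0 ≤ ρ) (hs : s ≤ n * (Q * S) * θ ^ 2)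
    (h1 : 1 / (κ * S) * (ρ - s) ≤ D + (1 / (κ * S)) ^ 2 * (m * α * ρ))
    (h2 : (1 - σ) * a ≤ D + σ ^ 2 / (1 - σ) * (1 / (κ * S)) ^ 2 * (m * α * ρ)) :
    (1 / 2 + 1 / Q / 2) * ρ + 4 * n * α / (1 / Q) * a - 1 / 2 * s ≤
      (8 * α + 2 * θ ^ 2 + 2) * ((σ / (1 - σ)) ^ 2 *
        (n ^ 5 * m ^ 2 + n ^ 4 * m ^ 4 + n ^ 3 * m ^ 2 * D) + (n + (n + κ) * D)) * S := by
  have hQ0 : 0 < Q := by linarith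
  have hκ0 : 0 < κ := lt_of_lt_of_le (by positivity) hκ
  have hσ' : 0 < 1 - σ := by linarith
  have hS0 : 0 < S := hQ0.trans_le hQS
  have hS1 : 1 ≤ S := hQ.trans hQS
  set q := σ / (1 - σ) with hq
  have hq0 : 0 ≤ q := by positivity
  -- the step size is so small that the second-order term is of relative size `1 / S`
  have hmα : m * α ≤ κ / 2 := by
    nlinarith [mul_le_mul_of_nonneg_right hm (by positivity : 0 ≤ m * α)]
  have hsecond : (1 / (κ * S)) ^ 2 * (m * α * ρ) ≤ 1 / (κ * S) * (ρ / (2 * S)) := by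
    calc (1 / (κ * S)) ^ 2 * (m * α * ρ) ≤ (1 / (κ * S)) ^ 2 * (κ / 2 * ρ) := by gcongr
      _ = _ := by field_simp
  have hdesc : ρ - s ≤ κ * S * D + ρ / (2 * S) := by
    have h3 := mul_le_mul_of_nonneg_left (h1.trans (add_le_add_right hsecond D))
      (by positivity : 0 ≤ κ * S)
    calc ρ - s = κ * S * (1 / (κ * S) * (ρ - s)) := by field_simp
      _ ≤ κ * S * (D + 1 / (κ * S) * (ρ / (2 * S))) := h3
      _ = _ := by field_simp
  have hρS : ρ / (2 * S) ≤ ρ / 2 := by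
    apply div_le_div_of_nonneg_left hρ (by norm_num); linarith
  have hρle : ρ ≤ 2 * κ * S * D + 2 * (n * (Q * S) * θ ^ 2) := by linarith
  have hρ2S : ρ / (2 * S) ≤ κ * D + n * Q * θ ^ 2 := by
    rw [div_le_iff₀ (by positivity)]; linarith
  have hρQ : ρ / Q ≤ 2 * κ * S * D + 2 * (n * θ ^ 2 * S) := by
    rw [div_le_iff₀ hQ0]
    have : 0 ≤ κ * S * D := by positivity
    nlinarith [mul_le_mul_of_nonneg_left hQ this]
  have hρSQ : ρ / (2 * S) ≤ ρ / Q / 2 := by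
    rw [div_div]
    apply div_le_div_of_nonneg_left hρ (by positivity); linarith
  have hown : 1 / 2 * (ρ - s) + ρ / Q / 2 ≤ 2 * κ * S * D + 3 / 2 * (n * θ ^ 2 * S) := by
    linarith
  have ha : a ≤ (1 + q) * D + q ^ 2 * ((1 / (κ * S)) ^ 2 * (m * α * ρ)) := by
    have e : (1 + q) * D + q ^ 2 * ((1 / (κ * S)) ^ 2 * (m * α * ρ))
        = (D + σ ^ 2 / (1 - σ) * (1 / (κ * S)) ^ 2 * (m * α * ρ)) / (1 - σ) := by
      rw [hq]; field_simp; ring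
    rw [e, le_div_iff₀ hσ']
    linarith
  have hcons : Q * ((1 / (κ * S)) ^ 2 * (m * α * ρ)) ≤ S * D + S * (n * θ ^ 2 / (2 * α)) := by
    have hακ : 2 * α ≤ κ := by nlinarith
    have hQQ : Q * Q ≤ S * S := by gcongr
    calc Q * ((1 / (κ * S)) ^ 2 * (m * α * ρ))
        ≤ Q * (1 / (κ * S) * (κ * D + n * Q * θ ^ 2)) := by
          refine mul_le_mul_of_nonneg_left (hsecond.trans ?_) hQ0.le
          exact mul_le_mul_of_nonneg_left hρ2S (by positivity)
      _ = Q / S * D + Q * Q / S * (n * θ ^ 2 / κ) := by field_simp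
      _ ≤ S * D + S * (n * θ ^ 2 / (2 * α)) := by
          gcongr
          · rw [div_le_iff₀ hS0]; nlinarith
          · rw [div_le_iff₀ hS0]; exact hQQ
  have hdis : 4 * n * α / (1 / Q) * a
      ≤ (8 * α * n * D + q ^ 2 * (8 * α * n * D + 2 * θ ^ 2 * n ^ 2)) * S := by
    calc 4 * n * α / (1 / Q) * a = 4 * n * α * (Q * a) := by field_simp
      _ ≤ 4 * n * α * (Q * ((1 + q) * D + q ^ 2 * ((1 / (κ * S)) ^ 2 * (m * α * ρ)))) := by gcongr
      _ = 4 * n * α * (Q * ((1 + q) * D) + q ^ 2 * (Q * ((1 / (κ * S)) ^ 2 * (m * α * ρ)))) := by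
          ring
      _ ≤ 4 * n * α * (S * ((2 + q ^ 2) * D) + q ^ 2 * (S * D + S * (n * θ ^ 2 / (2 * α)))) := by
          have hq2 : 1 + q ≤ 2 + q ^ 2 := by nlinarith [sq_nonneg (q - 1)]
          gcongr
      _ = _ := by field_simp; ring
  have hfinal := regret_coefficients_le (θ := θ) hα hD hn hm hκ0.le q
  calc (1 / 2 + 1 / Q / 2) * ρ + 4 * n * α / (1 / Q) * a - 1 / 2 * s
      = 1 / 2 * (ρ - s) + ρ / Q / 2 + 4 * n * α / (1 / Q) * a := by ring
    _ ≤ (2 * κ * D + 3 / 2 * (n * θ ^ 2)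
      + (8 * α * n * D + q ^ 2 * (8 * α * n * D + 2 * θ ^ 2 * n ^ 2))) * S := by linarith
    _ ≤ _ := by gcongr

/-! ### The regret bound -/

theorem theorem2 (α θ : ℝ) (hα : 0 < α) (hθ : 0 < θ) :
    ∃ C : ℝ, 0 < C ∧
      ∀ (n m T : ℕ) (G : Digraph (Fin n)) (W : Matrix (Fin n) (Fin n) ℝ)
        (h : Fin n → ℕ → Vec m) (z : Fin n → ℕ → ℝ) (ystar : Vec m) (x₁ : Fin n → Vec m) (κ : ℝ)
        (Ω : Type*) [MeasurableSpace Ω] (P : Measure Ω) [IsProbabilityMeasure P]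
        (u : Fin n → ℕ → Ω → Vec m),
        1 ≤ m → 2 ≤ T → IsNetwork G W →
        IsMinOn (cumLoss h z T) Set.univ ystar →
        (∃ t < T, (covMatrix h t).rank = m) →
        (∀ i, ∀ t < T, ‖h i t‖ ^ 2 ≤ α) →
        (∀ i, ∀ t < T, |inner ℝ (h i t) ystar - z i t| ≤ θ) →
        α < n →
        2 * n * (m : ℝ) ^ 2 * α / (n - α) < κ →
        IsUniformDirections P T u →
        (∀ i j, ∀ t < T, Integrable (fun ω => sqLoss (h j t) (z j t)
          (dolrBFProcess G W h z T (3 / 4) (1 / √(T : ℝ)) κ x₁ u t i ω)) P) ∧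
        ∀ i, expRegret P h z T
              (dolrBFProcess G W h z T (3 / 4) (1 / √(T : ℝ)) κ x₁ u) ystar i ≤
          C * ((sigmaTwo W / (1 - sigmaTwo W)) ^ 2 *
                  ((n : ℝ) ^ 5 * (m : ℝ) ^ 2 + (n : ℝ) ^ 4 * (m : ℝ) ^ 4
                    + (n : ℝ) ^ 3 * (m : ℝ) ^ 2 * initDist x₁ ystar)
                + (n + (n + κ) * initDist x₁ ystar))
            * (T : ℝ) ^ (3 / 4 : ℝ) := by
  refine ⟨8 * α + 2 * θ ^ 2 + 2, by positivity, ?_⟩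
  intro n m T G W h z y x₁ κ Ω _ P _ u hm hT hnet _ _ hh hy hαn hκ hu
  have hT0 : (0 : ℝ) < T := by positivity
  set ε : ℝ := 1 / √(T : ℝ) with hε_def
  have hε : ε ≠ 0 := by positivity
  set Q : ℝ := (T : ℝ) ^ (1 / 4 : ℝ) with hQ_def
  have hQ : 1 ≤ Q := Real.one_le_rpow (by exact_mod_cast (by omega : 1 ≤ T)) (by norm_num)
  have hQ3 : (T : ℝ) ^ (3 / 4 : ℝ) = Q ^ 3 := by
    rw [hQ_def, ← Real.rpow_mul_natCast hT0.le]; norm_num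
  have hQ4 : (T : ℝ) = Q ^ 4 := by
    rw [hQ_def, ← Real.rpow_mul_natCast hT0.le]; norm_num
  have hκ' : 2 * (m : ℝ) ^ 2 * α ≤ κ := by
    refine le_trans ?_ hκ.le
    rw [le_div_iff₀ (by linarith)]
    have : 0 ≤ 2 * (m : ℝ) ^ 2 * α := by positivity
    nlinarith
  have hm1 : (1 : ℝ) ≤ m := by exact_mod_cast hm
  have hκ0 : 0 < κ := lt_of_lt_of_le (by positivity) hκ'
  have hσ0 : 0 ≤ sigmaTwo W := (Matrix.toEuclideanLin W).singularValues_nonneg 1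
  have hσ1 := hnet.sigmaTwo_lt_one
  set X : ℕ → Ω → Fin n → Vec m := fun t ω i ↦ dolrBFProcess G W h z T (3 / 4) ε κ x₁ u t i ω
    with hX
  have H : ∀ t < T, IsRandomRound P (X t) (fun ω j ↦ u j t ω) := fun t ht ↦
    hu.isRandomRound_dolrBFProcess hnet h z (3 / 4) ε κ x₁ ht
  have hloss : ∀ i j, ∀ t < T, Integrable (fun ω ↦ sqLoss (h j t) (z j t) (X t ω i)) P :=
    fun i j t ht ↦ (H t ht).integrable (F := fun q ↦ sqLoss (h j t) (z j t) (q.1 i))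
      (by unfold sqLoss; fun_prop)
  refine ⟨hloss, fun i ↦ ?_⟩
  have hn1 : (1 : ℝ) ≤ n := by exact_mod_cast i.pos
  set η : ℝ := 1 / (κ * Q ^ 3) with hη
  have hη0 : 0 ≤ η := by positivity
  have hnext : ∀ t, X (t + 1) = fun ω ↦ nextEstimate W ε η (fun j ↦ h j t) (fun j ↦ z j t) (X t ω)
      (fun j ↦ u j t ω) := fun t ↦ by
    funext ω
    have := dolrBF_succ hnet h z T (3 / 4) ε κ x₁ (fun j s ↦ u j s ω) t
    rw [hQ3, ← hη] at this
    exact this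
  set V : ℕ → ℝ := fun t ↦ ∫ ω, ∑ i, ‖X t ω i - y‖ ^ 2 ∂P with hV
  set A : ℕ → ℝ := fun t ↦ ∫ ω, disagreement (X t ω) ∂P with hA
  set R : ℕ → ℝ := fun t ↦ residualEnergy P (fun j ↦ h j t) (fun j ↦ z j t) (X t) with hR
  set S : ℕ → ℝ := fun t ↦ ∑ j, (inner ℝ (h j t) y - z j t) ^ 2 with hS
  have hVstep : ∀ t < T, V (t + 1) + η * (R t - S t) ≤ V t + η ^ 2 * (m * α * R t) :=
    fun t ht ↦ by
      have := (H t ht).integral_dist_nextEstimate_le hm hnet.stochastic hε hη0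
        (fun j ↦ hh j t ht) (fun j ↦ z j t) y
      simp only [hV, hR, hS, hnext t]
      linarith
  have hAstep : ∀ t < T, A (t + 1) + (1 - sigmaTwo W) * A t
      ≤ A t + sigmaTwo W ^ 2 / (1 - sigmaTwo W) * η ^ 2 * (m * α * R t) := fun t ht ↦ by
    have := (H t ht).integral_disagreement_nextEstimate_le hm hnet.stochastic hσ1 hε η
      (fun j ↦ hh j t ht) (fun j ↦ z j t)
    simp only [hA, hR, hnext t]
    linarith
  have hV0 : V 0 = initDist x₁ y := by simp [hV, hX, dolrBFProcess, dolrBF, initDist]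
  have hA0 : A 0 ≤ initDist x₁ y := by
    have : A 0 = disagreement x₁ := by simp [hA, hX, dolrBFProcess, dolrBF]
    rw [this]
    exact disagreement_le x₁ y
  have hVT : 0 ≤ V T := integral_nonneg fun _ ↦ Finset.sum_nonneg fun _ _ ↦ sq_nonneg _
  have hAT : 0 ≤ A T := integral_nonneg fun _ ↦ disagreement_nonneg _
  have hVsum := add_sum_range_le hVstep
  have hAsum := add_sum_range_le hAstep
  simp only [← Finset.mul_sum, Finset.sum_sub_distrib] at hVsum hAsum
  have hSsum : ∑ t ∈ Finset.range T, S t ≤ n * (Q * Q ^ 3) * θ ^ 2 := by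
    calc ∑ t ∈ Finset.range T, S t ≤ ∑ t ∈ Finset.range T, n * θ ^ 2 := by
          refine Finset.sum_le_sum fun t ht ↦ ?_
          refine (Finset.sum_le_sum fun j _ ↦ sq_le_sq.2 ((hy j t (Finset.mem_range.1 ht)).trans
            (le_abs_self θ))).trans_eq ?_
          simp
      _ = _ := by
          rw [Finset.sum_const, Finset.card_range, nsmul_eq_mul]
          linear_combination (n * θ ^ 2) * hQ4
  have hRsum : 0 ≤ ∑ t ∈ Finset.range T, R t :=
    Finset.sum_nonneg fun t _ ↦ residualEnergy_nonneg _ _ _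
  have hregret : expRegret P h z T (dolrBFProcess G W h z T (3 / 4) ε κ x₁ u) y i
      ≤ (1 / 2 + 1 / Q / 2) * ∑ t ∈ Finset.range T, R t
        + 4 * n * α / (1 / Q) * ∑ t ∈ Finset.range T, A t
        - 1 / 2 * ∑ t ∈ Finset.range T, S t := by
    have hcum : cumLoss h z T y = 1 / 2 * ∑ t ∈ Finset.range T, S t := by
      simp only [cumLoss, sqLoss, hS, Finset.mul_sum]
    rw [expRegret, hcum]
    refine sub_le_sub_right ?_ _
    rw [Finset.mul_sum, Finset.mul_sum, ← Finset.sum_add_distrib]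
    refine Finset.sum_le_sum fun t ht ↦ ?_
    exact (H t (Finset.mem_range.1 ht)).integral_sum_sqLoss_le hα.le (by positivity)
      ((div_le_one (by positivity)).2 hQ) (fun j ↦ hh j t (Finset.mem_range.1 ht)) _ i
  rw [hQ3]
  refine hregret.trans (regret_arith hα (Finset.sum_nonneg fun _ _ ↦ sq_nonneg _) hσ0 hσ1 hn1 hm1
    hκ' hQ (le_self_pow₀ hQ (by norm_num)) hRsum hSsum ?_ ?_)
  · rw [hV0] at hVsum; linarith
  · linarith
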